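/- Let $M\ge 1$ and $N\ge 2$ be integers and let $A=(a_{kj})_{0\le k\le M-1,\,0\le j\le N-1}$ be a complex $M\times N$ matrix such that $\frac1N A^*A=I_N$ (that is, $\frac{1}{\sqrt N}A$ is an isometry) and whose first row is constantly $1$, i.e. $a_{0,j}=1$ for $j=0,\dots,N-1$. For $k\in\{0,\dots,M-1\}$ define $$m_k(x)=\sum_{j=0}^{N-1}a_{kj}\,\chi_{[j/N,(j+1)/N)}(x),\qquad V_k:L^2[0,1]\to L^2[0,1],\quad V_kf(x)=m_k(x)\,f(Nx \bmod 1),$$ where $L^2[0,1]$ is the complex $L^2$ space of Lebesgue measure. For a finite word $\omega=\omega_1\cdots\omega_n$ with letters in $\{0,\dots,M-1\}$ put $V_\omega=V_{\omega_1}\cdots V_{\omega_n}$, with $V_\omega=I$ for the empty word, and let $\mathbf 1$ be the constant function $1$. Then the family $\{V_\omega\mathbf 1\}$, indexed by all finite words $\omega$ (including the empty word) whose last letter is not $0$, is a Parseval frame for $L^2[0,1]$: for every $f\in L^2[0,1]$, $$\|f\|^2=\sum_{\omega\text{ not ending in }0}|\langle f,V_\omega\mathbf 1\rangle|^2 .$$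 -/

import Mathlib

open MeasureTheory

noncomputable section

namespace WalshFrame

/-- A family of vectors `e i` in a Hilbert space is a Parseval frame if
`‖v‖² = ∑ i, |⟨v, e i⟩|²` for every vector `v`. -/
def IsParsevalFrame {ι H : Type*} [NormedAddCommGroup H] [InnerProductSpace ℂ H]
    (e : ι → H) : Prop :=
  ∀ v : H, HasSum (fun i => ‖inner ℂ (e i) v‖ ^ 2) (‖v‖ ^ 2)

/-- Lebesgue measure on `[0, 1]`. -/
abbrev μI : Measure ℝ := volume.restrict (Set.Icc (0 : ℝ) 1)

/-- The Hilbert space `L²[0, 1]`, with complex scalars. -/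
abbrev L2I : Type := Lp ℂ 2 μI

/-- The map `x ↦ N x mod 1`. -/
def shiftMap (N : ℕ) (x : ℝ) : ℝ := Int.fract ((N : ℝ) * x)

/-- The map `x ↦ N x mod 1` preserves Lebesgue measure on `[0, 1]`. -/
theorem measurePreserving_shiftMap (N : ℕ) [NeZero N] :
    MeasurePreserving (shiftMap N) μI μI := by
  have hI : μI = volume.restrict (Set.Ioc (0 : ℝ) (0 + 1)) := by
    rw [zero_add]; exact (restrict_Ioc_eq_restrict_Icc).symm
  have hmk : MeasurePreserving (fun x : ℝ => (x : UnitAddCircle)) μI volume := by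
    rw [hI]; exact UnitAddCircle.measurePreserving_mk 0
  have hpow : MeasurePreserving (fun y : UnitAddCircle => (N : ℤ) • y) volume volume :=
    MeasureTheory.Measure.measurePreserving_zsmul volume (by exact_mod_cast NeZero.ne N)
  let s : UnitAddCircle → ℝ := fun y => (AddCircle.measurableEquivIco 1 0 y : ℝ)
  have hsm : Measurable s :=
    measurable_subtype_coe.comp (AddCircle.measurableEquivIco 1 0).measurable
  have hs : ∀ x : ℝ, s (x : UnitAddCircle) = Int.fract x := by
    intro x
    have := AddCircle.coe_equivIco_mk_apply (1 : ℝ) x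
    rw [div_one, mul_one] at this
    exact this
  have hsec : MeasurePreserving s volume μI := by
    refine ⟨hsm, ?_⟩
    rw [← hmk.map_eq, Measure.map_map hsm hmk.measurable]
    have : (s ∘ fun x : ℝ => (x : UnitAddCircle)) =ᵐ[μI] id := by
      have hI' : μI = volume.restrict (Set.Ico (0 : ℝ) 1) :=
        (restrict_Ico_eq_restrict_Icc).symm
      rw [hI']
      filter_upwards [ae_restrict_mem measurableSet_Ico] with x hx
      simp only [Function.comp_apply, hs, id]
      exact Int.fract_eq_self.2 ⟨hx.1, hx.2⟩
    rw [Measure.map_congr this, Measure.map_id]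
  have h := (hsec.comp hpow).comp hmk
  have heq : (s ∘ fun y : UnitAddCircle => (N : ℤ) • y) ∘ (fun x : ℝ => (x : UnitAddCircle))
      = shiftMap N := by
    funext x
    have : ((N : ℤ) • (x : UnitAddCircle)) = (((N : ℝ) * x : ℝ) : UnitAddCircle) := by
      rw [← AddCircle.coe_zsmul]; simp
    simp only [Function.comp_apply, this, hs, shiftMap]
  rwa [heq] at h

variable {M N : ℕ}

/-- The step function `m_k = ∑ j, a_{kj} χ_[j/N, (j+1)/N)`. -/
def stepFun (A : Matrix (Fin M) (Fin N) ℂ) (k : Fin M) (x : ℝ) : ℂ :=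
  ∑ j : Fin N,
    (Set.Ico ((j : ℝ) / N) (((j : ℝ) + 1) / N)).indicator (fun _ => A k j) x

/-- The step function `m_k` is essentially bounded. -/
theorem memLp_stepFun (A : Matrix (Fin M) (Fin N) ℂ) (k : Fin M) :
    MemLp (stepFun A k) ⊤ μI :=
  memLp_finsetSum _ fun j _ => (memLp_const (A k j)).indicator measurableSet_Ico

/-- The bounded operator `V_k` on `L²[0, 1]`, `V_k f (x) = m_k(x) f(N x mod 1)`: composition with
`x ↦ N x mod 1` followed by multiplication by `m_k`; see `walshOp_coeFn`. -/
def walshOp [NeZero N] (A : Matrix (Fin M) (Fin N) ℂ) (k : Fin M) : L2I →L[ℂ] L2I :=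
  ((ContinuousLinearMap.mul ℂ ℂ).holderL μI ⊤ 2 2 ((memLp_stepFun A k).toLp _)) ∘L
    (Lp.compMeasurePreservingₗᵢ ℂ (shiftMap N)
      (measurePreserving_shiftMap N)).toContinuousLinearMap

/-- The defining formula of `V_k`. -/
theorem walshOp_coeFn [NeZero N] (A : Matrix (Fin M) (Fin N) ℂ) (k : Fin M) (f : L2I) :
    walshOp A k f =ᵐ[μI] fun x => stepFun A k x * f (shiftMap N x) := by
  have h1 := (ContinuousLinearMap.mul ℂ ℂ).coeFn_holder (r := 2)
    ((memLp_stepFun A k).toLp _) (Lp.compMeasurePreserving (shiftMap N)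
      (measurePreserving_shiftMap N) f)
  filter_upwards [h1, (memLp_stepFun A k).coeFn_toLp,
    Lp.coeFn_compMeasurePreserving f (measurePreserving_shiftMap N)] with x h1 h2 h3
  refine h1.trans ?_
  rw [h2, h3]
  rfl

/-- For a word `ω = ω₁ ⋯ ωₙ` the operator `V_ω = V_{ω₁} ⋯ V_{ωₙ}`; for the empty word it is the
identity. -/
def wordOp [NeZero N] (A : Matrix (Fin M) (Fin N) ℂ) (ω : List (Fin M)) : L2I →L[ℂ] L2I :=
  (ω.map (walshOp A)).prod

/-- The constant function `1` in `L²[0, 1]`. -/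
def oneL2 : L2I := Lp.const 2 μI (1 : ℂ)

/-- The finite words over `{0, …, M - 1}`, the empty word included, whose last letter is
not `0`. -/
abbrev WordsNotEndingInZero (M : ℕ) [NeZero M] : Type :=
  {ω : List (Fin M) // ω.getLast? ≠ some 0}

end WalshFrame

end

/-! Write `S_j f (x) = √N χ_[j/N, (j+1)/N)(x) f(N x mod 1)` for the Cuntz isometries of the
subdivision of `[0, 1)` into `N` equal intervals. Then `V_k = ∑ j, (a_{kj} / √N) S_j`, and because
`A / √N` is an isometry the completely positive map `Φ(B) = ∑ k, V_k B V_k⋆` equals `∑ j, S_j B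
S_j⋆`: it does not depend on `A`, and `Φ(1) = 1`.

Let `P` be the projection onto the constants. Since `V_0 1 = 1`, the words of length at most `n` not
ending in `0` have frame operator `Φⁿ(P)`, so the claim is that the positive operators `1 - Φⁿ(P) =
Φⁿ(1 - P)` tend weakly to `0`. They are contractions, so it is enough to test them on the dense set
of Lipschitz functions. As `S_j⋆ f (x) = f((x + j)/N) / √N`, a word of length `n` in the `S_j⋆`
restricts `f` to an interval of length `N⁻ⁿ`, rescaled to `[0, 1]`, and if `f` is `K`-Lipschitz such
a restriction is within `K / Nⁿ` of a constant. Hence `⟨Φⁿ(1 - P) f, f⟩ ≤ (K / Nⁿ)²`. -/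

namespace WalshFrame

open Filter Topology ContinuousLinearMap
open scoped Matrix

theorem hasSum_of_tendsto_sum_of_nonneg {ι κ : Type*} {g : ι → ℝ} (hg : ∀ i, 0 ≤ g i)
    {l : Filter κ} [l.NeBot] {s : κ → Finset ι} (hs : Tendsto s l atTop) {a : ℝ}
    (h : Tendsto (fun n => ∑ i ∈ s n, g i) l (𝓝 a)) : HasSum g a := by
  have hle (t : Finset ι) : ∑ i ∈ t, g i ≤ a := by
    refine ge_of_tendsto h ?_
    filter_upwards [hs.eventually_ge_atTop t] with n hn
    exact Finset.sum_le_sum_of_subset_of_nonneg hn fun i _ _ => hg i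
  have hsum : HasSum g (∑' i, g i) := (summable_of_sum_le hg hle).hasSum
  rwa [tendsto_nhds_unique (hsum.comp hs) h] at hsum

section Words

variable {α : Type*} [Fintype α] [DecidableEq α] (z : α)

/-- The words of length at most `n` whose last letter is not `z`, the empty word included. -/
def shortWords : ℕ → Finset (List α)
  | 0 => {[]}
  | n + 1 => insert [] (((Finset.univ ×ˢ shortWords n).image fun p => p.1 :: p.2).erase [z])

theorem mem_shortWords {n : ℕ} {ω : List α} :
    ω ∈ shortWords z n ↔ ω.getLast? ≠ some z ∧ ω.length ≤ n := by
  induction n generalizing ω with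
  | zero => cases ω <;> simp [shortWords]
  | succ n ih =>
    cases ω with
    | nil => simp [shortWords]
    | cons k τ => cases τ <;> simp [shortWords, ih]

theorem tendsto_subtype_shortWords :
    Tendsto (fun n => (shortWords z n).subtype fun ω => ω.getLast? ≠ some z) atTop atTop := by
  refine tendsto_atTop_finset_of_monotone (fun m n hmn ω hω => ?_) fun ω => ⟨ω.1.length, ?_⟩
  · simp only [Finset.mem_subtype, mem_shortWords] at hω ⊢
    exact ⟨hω.1, hω.2.trans hmn⟩
  · simpa only [Finset.mem_subtype, mem_shortWords, le_refl, and_true] using ω.2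

/-- The empty word on the left plays the part of the word `[z]` on the right. -/
theorem sum_shortWords_succ {G : Type*} [AddCommMonoid G] (g : List α → G) (hg : g [z] = g [])
    (n : ℕ) :
    ∑ ω ∈ shortWords z (n + 1), g ω = ∑ k, ∑ ω ∈ shortWords z n, g (k :: ω) := by
  have hmem : [z] ∈ (Finset.univ ×ˢ shortWords z n).image fun p => p.1 :: p.2 := by
    simp [mem_shortWords]
  rw [shortWords, Finset.sum_insert (by simp), ← hg, Finset.add_sum_erase _ g hmem,
    Finset.sum_image (by rintro ⟨a, b⟩ _ ⟨c, d⟩ _ h; simpa using h), Finset.sum_product]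

end Words

section KrausMap

variable {ι R : Type*} [Fintype ι] [Ring R] [StarRing R]

/-- The completely positive map `B ↦ ∑ k, V k * B * (V k)⋆` with Kraus operators `V`. Only its
additivity is recorded, so that `R` need not be an algebra. -/
def krausMap (V : ι → R) : R →+ R where
  toFun B := ∑ k, V k * B * star (V k)
  map_zero' := by simp
  map_add' B C := by simp only [mul_add, add_mul, Finset.sum_add_distrib]

theorem krausMap_apply (V : ι → R) (B : R) : krausMap V B = ∑ k, V k * B * star (V k) := rfl

theorem iterate_krausMap_nonneg [PartialOrder R] [StarOrderedRing R] (V : ι → R) {B : R}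
    (hB : 0 ≤ B) (n : ℕ) : 0 ≤ (krausMap V)^[n] B := by
  induction n with
  | zero => exact hB
  | succ n ih =>
    rw [Function.iterate_succ_apply', krausMap_apply]
    exact Finset.sum_nonneg fun k _ => star_right_conjugate_nonneg ih (V k)

theorem krausMap_sum_smul [DecidableEq ι] {κ 𝕜 : Type*} [Fintype κ] [CommRing 𝕜] [StarRing 𝕜]
    [Algebra 𝕜 R] [StarModule 𝕜 R] {U : Matrix κ ι 𝕜} (hU : Uᴴ * U = 1) (S : ι → R) :
    krausMap (fun k => ∑ j, U k j • S j) = krausMap S := by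
  have hδ (j l : ι) : ∑ k, star (U k l) * U k j = if l = j then 1 else 0 := by
    simp only [← Matrix.one_apply, ← hU, Matrix.mul_apply, Matrix.conjTranspose_apply]
  ext B
  calc krausMap (fun k => ∑ j, U k j • S j) B
      = ∑ k, ∑ l, ∑ j, (star (U k l) * U k j) • (S j * B * star (S l)) := by
        simp only [krausMap_apply, star_sum, star_smul, Finset.sum_mul, Finset.mul_sum,
          smul_mul_assoc, mul_smul_comm, Finset.smul_sum, smul_smul]
    _ = ∑ l, ∑ j, (∑ k, star (U k l) * U k j) • (S j * B * star (S l)) := by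
        simp only [Finset.sum_smul]
        rw [Finset.sum_comm]
        exact Finset.sum_congr rfl fun l _ => Finset.sum_comm
    _ = krausMap S B := by
        simp only [hδ, ite_smul, one_smul, zero_smul, Finset.sum_ite_eq, Finset.mem_univ, if_true,
          krausMap_apply]

end KrausMap

section QuadraticForms

open InnerProductSpace

variable {𝕜 H : Type*} [RCLike 𝕜] [NormedAddCommGroup H] [InnerProductSpace 𝕜 H]

theorem reApplyInnerSelf_sub (B C : H →L[𝕜] H) (f : H) :
    (B - C).reApplyInnerSelf f = B.reApplyInnerSelf f - C.reApplyInnerSelf f := by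
  simp only [reApplyInnerSelf_apply, sub_apply, inner_sub_left, map_sub]

theorem reApplyInnerSelf_sum {ι : Type*} (s : Finset ι) (B : ι → H →L[𝕜] H) (f : H) :
    (∑ i ∈ s, B i).reApplyInnerSelf f = ∑ i ∈ s, (B i).reApplyInnerSelf f := by
  simp only [reApplyInnerSelf_apply, sum_apply, sum_inner, map_sum]

theorem reApplyInnerSelf_one (f : H) : (1 : H →L[𝕜] H).reApplyInnerSelf f = ‖f‖ ^ 2 := by
  rw [reApplyInnerSelf_apply, one_apply_eq_self, norm_sq_eq_re_inner (𝕜 := 𝕜)]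

theorem reApplyInnerSelf_rankOne_self (x f : H) :
    (rankOne 𝕜 x x).reApplyInnerSelf f = ‖inner 𝕜 x f‖ ^ 2 := by
  rw [reApplyInnerSelf_apply, inner_left_rankOne_apply, inner_mul_symm_re_eq_norm, norm_mul,
    norm_inner_symm f x, sq]

theorem reApplyInnerSelf_nonneg {B : H →L[𝕜] H} (hB : 0 ≤ B) (f : H) : 0 ≤ B.reApplyInnerSelf f :=
  ((nonneg_iff_isPositive B).1 hB).2 f

theorem reApplyInnerSelf_mono {B C : H →L[𝕜] H} (hBC : B ≤ C) (f : H) :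
    B.reApplyInnerSelf f ≤ C.reApplyInnerSelf f := by
  rw [← sub_nonneg, ← reApplyInnerSelf_sub]
  exact hBC.2 f

theorem reApplyInnerSelf_add_add_sub (B : H →L[𝕜] H) (f g : H) :
    B.reApplyInnerSelf (f + g) + B.reApplyInnerSelf (f - g) =
      2 * (B.reApplyInnerSelf f + B.reApplyInnerSelf g) := by
  simp only [reApplyInnerSelf_apply, map_add, map_sub, inner_add_left, inner_sub_left,
    inner_add_right, inner_sub_right]
  ring

theorem tendsto_reApplyInnerSelf_zero_of_dense {κ : Type*} {l : Filter κ} {B : κ → H →L[𝕜] H}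
    (hB₀ : ∀ n, 0 ≤ B n) (hB₁ : ∀ n, B n ≤ 1) {s : Set H} (hs : Dense s)
    (h : ∀ g ∈ s, Tendsto (fun n => (B n).reApplyInnerSelf g) l (𝓝 0)) (f : H) :
    Tendsto (fun n => (B n).reApplyInnerSelf f) l (𝓝 0) := by
  have hsplit (n : κ) (g : H) :
      (B n).reApplyInnerSelf f ≤ 2 * ((B n).reApplyInnerSelf g + ‖f - g‖ ^ 2) := by
    have hparallelogram := reApplyInnerSelf_add_add_sub (B n) g (f - g)
    rw [add_sub_cancel] at hparallelogram
    have hle := (reApplyInnerSelf_mono (hB₁ n) (f - g)).trans_eq (reApplyInnerSelf_one _)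
    linarith [reApplyInnerSelf_nonneg (hB₀ n) (g - (f - g))]
  refine Metric.tendsto_nhds.2 fun ε hε => ?_
  obtain ⟨g, hgs, hfg⟩ := hs.exists_dist_lt f (Real.sqrt_pos.2 (by positivity : 0 < ε / 4))
  rw [dist_eq_norm, Real.lt_sqrt (norm_nonneg _)] at hfg
  filter_upwards [(h g hgs).eventually_lt_const (by positivity : 0 < ε / 4)] with n hn
  rw [Real.dist_0_eq_abs, abs_of_nonneg (reApplyInnerSelf_nonneg (hB₀ n) f)]
  linarith [hsplit n g]

theorem reApplyInnerSelf_one_sub_rankOne_le {x : H} (hx : ‖x‖ = 1) (c : 𝕜) (f : H) :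
    (1 - rankOne 𝕜 x x).reApplyInnerSelf f ≤ ‖f - c • x‖ ^ 2 := by
  have hre : RCLike.re (inner 𝕜 f (c • x)) ≤ ‖c‖ * ‖inner 𝕜 x f‖ := by
    refine (RCLike.re_le_norm _).trans_eq ?_
    rw [inner_smul_right, norm_mul, norm_inner_symm]
  rw [reApplyInnerSelf_sub, reApplyInnerSelf_one, reApplyInnerSelf_rankOne_self,
    norm_sub_sq (𝕜 := 𝕜), norm_smul, hx, mul_one]
  linarith [sq_nonneg (‖c‖ - ‖inner 𝕜 x f‖)]

variable [CompleteSpace H]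

theorem rankOne_self_le_one {x : H} (hx : ‖x‖ = 1) : rankOne 𝕜 x x ≤ 1 :=
  le_def _ _ |>.2 (.of_isStarProjection (isStarProjection_rankOne_self hx).one_sub)

variable {ι : Type*} [Fintype ι]

theorem reApplyInnerSelf_krausMap (V : ι → H →L[𝕜] H) (B : H →L[𝕜] H) (f : H) :
    (krausMap V B).reApplyInnerSelf f = ∑ k, B.reApplyInnerSelf (adjoint (V k) f) := by
  rw [krausMap_apply, reApplyInnerSelf_sum]
  simp only [reApplyInnerSelf_apply, mul_apply_eq_comp, star_eq_adjoint, ← adjoint_inner_right]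

theorem krausMap_rankOne (V : ι → H →L[𝕜] H) (x : H) :
    krausMap V (rankOne 𝕜 x x) = ∑ k, rankOne 𝕜 (V k x) (V k x) := by
  simp only [krausMap_apply, mul_def, InnerProductSpace.comp_rankOne, rankOne_comp, star_eq_adjoint,
    adjoint_adjoint]

end QuadraticForms

section FrameOperator

open InnerProductSpace (rankOne)

variable {ι 𝕜 H : Type*} [Fintype ι] [RCLike 𝕜] [NormedAddCommGroup H]

/-- The frame operator of the vectors `V_ω x = V_{ω₁} ⋯ V_{ωₘ} x`, where `ω` runs over the words of
length at most `n` not ending in `z`. -/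
noncomputable def partialFrameOp [DecidableEq ι] [InnerProductSpace 𝕜 H] (V : ι → H →L[𝕜] H) (x : H)
    (z : ι) (n : ℕ) : H →L[𝕜] H :=
  ∑ ω ∈ shortWords z n, rankOne 𝕜 ((ω.map V).prod x) ((ω.map V).prod x)

theorem reApplyInnerSelf_partialFrameOp [DecidableEq ι] [InnerProductSpace 𝕜 H]
    (V : ι → H →L[𝕜] H) (x : H)
    (z : ι) (n : ℕ) (f : H) : (partialFrameOp V x z n).reApplyInnerSelf f =
      ∑ ω ∈ shortWords z n, ‖inner 𝕜 ((ω.map V).prod x) f‖ ^ 2 := by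
  simp only [partialFrameOp, reApplyInnerSelf_sum, reApplyInnerSelf_rankOne_self]

/-- Since `V_z x = x`, padding a word by letters `z` does not change its vector, so that the words
of length at most `n` not ending in `z` give the same vectors as all words of length `n`. -/
theorem partialFrameOp_eq_iterate_krausMap [DecidableEq ι] [InnerProductSpace 𝕜 H]
    [CompleteSpace H] {V : ι → H →L[𝕜] H} {x : H} {z : ι} (hx : V z x = x) (n : ℕ) :
    partialFrameOp V x z n = (krausMap V)^[n] (rankOne 𝕜 x x) := by
  induction n with
  | zero => simp [partialFrameOp, shortWords]
  | succ n ih =>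
    rw [Function.iterate_succ_apply', ← ih, partialFrameOp, partialFrameOp,
      sum_shortWords_succ z _ (by simp [hx]), map_sum, Finset.sum_comm]
    simp only [krausMap_rankOne, List.map_cons, List.prod_cons, mul_apply_eq_comp]

variable [InnerProductSpace ℂ H]

theorem isParsevalFrame_of_tendsto_partialFrameOp [DecidableEq ι] {V : ι → H →L[ℂ] H} {x : H}
    {z : ι} (h : ∀ f, Tendsto (fun n => (partialFrameOp V x z n).reApplyInnerSelf f) atTop
      (𝓝 (‖f‖ ^ 2))) :
    IsParsevalFrame fun ω : {ω : List ι // ω.getLast? ≠ some z} => (ω.1.map V).prod x := by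
  intro f
  refine hasSum_of_tendsto_sum_of_nonneg (fun _ => sq_nonneg _) (tendsto_subtype_shortWords z)
    ((h f).congr fun n => ?_)
  rw [reApplyInnerSelf_partialFrameOp]
  exact (Finset.sum_subtype_of_mem (fun ω => ‖inner ℂ ((ω.map V).prod x) f‖ ^ 2)
      fun ω hω => ((mem_shortWords z).1 hω).1).symm

theorem isParsevalFrame_of_tendsto_iterate_krausMap [CompleteSpace H] {V : ι → H →L[ℂ] H} {x : H}
    {z : ι} (hV : krausMap V 1 = 1) (hVx : V z x = x) (hx : ‖x‖ = 1) {s : Set H} (hs : Dense s)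
    (h : ∀ f ∈ s, Tendsto (fun n => ((krausMap V)^[n] (1 - rankOne ℂ x x)).reApplyInnerSelf f)
      atTop (𝓝 0)) :
    IsParsevalFrame fun ω : {ω : List ι // ω.getLast? ≠ some z} => (ω.1.map V).prod x := by
  classical
  have hdefect (n : ℕ) : 1 - partialFrameOp V x z n = (krausMap V)^[n] (1 - rankOne ℂ x x) := by
    rw [partialFrameOp_eq_iterate_krausMap hVx, iterate_map_sub, Function.iterate_fixed hV]
  simp only [← hdefect] at h
  have hnonneg (n : ℕ) : 0 ≤ partialFrameOp V x z n := by
    rw [partialFrameOp_eq_iterate_krausMap hVx]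
    exact iterate_krausMap_nonneg V
      ((nonneg_iff_isPositive _).2 (InnerProductSpace.isPositive_rankOne_self x)) n
  have hle (n : ℕ) : 0 ≤ 1 - partialFrameOp V x z n := by
    rw [hdefect]
    exact iterate_krausMap_nonneg V (sub_nonneg.2 (rankOne_self_le_one hx)) n
  refine isParsevalFrame_of_tendsto_partialFrameOp fun f => ?_
  have htendsto := (tendsto_reApplyInnerSelf_zero_of_dense hle
    (fun n => sub_le_self 1 (hnonneg n)) hs h f).const_sub (‖f‖ ^ 2)
  rw [sub_zero] at htendsto
  refine htendsto.congr fun n => ?_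
  rw [reApplyInnerSelf_sub, reApplyInnerSelf_one, sub_sub_cancel]

end FrameOperator

section Cells

variable {N : ℕ} {j : Fin N}

/-- The interval `[j/N, (j+1)/N)`, on which the step functions `m_k` are constant. -/
def cell (N : ℕ) (j : Fin N) : Set ℝ := Set.Ico ((j : ℝ) / N) (((j : ℝ) + 1) / N)

/-- The inverse branch of `x ↦ N x mod 1` with values in `cell N j`. -/
noncomputable def branch (N : ℕ) (j : Fin N) (x : ℝ) : ℝ := (x + j) / N

theorem measurableSet_cell : MeasurableSet (cell N j) := measurableSet_Ico

theorem lipschitzWith_branch : LipschitzWith (N : NNReal)⁻¹ (branch N j) := by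
  refine LipschitzWith.of_dist_le_mul fun x y => le_of_eq ?_
  rw [Real.dist_eq, Real.dist_eq, branch, branch, ← sub_div, add_sub_add_right_eq_sub, abs_div,
    Nat.abs_cast, NNReal.coe_inv, NNReal.coe_natCast, div_eq_inv_mul]

variable [NeZero N]

theorem mem_cell_iff_floor_eq {x : ℝ} : x ∈ cell N j ↔ ⌊N * x⌋ = j := by
  have hN : (0 : ℝ) < N := by exact_mod_cast NeZero.pos N
  rw [Int.floor_eq_iff, Int.cast_natCast, cell, Set.mem_Ico, div_le_iff₀' hN, lt_div_iff₀' hN]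

theorem eq_of_mem_cell {l : Fin N} {x : ℝ} (hj : x ∈ cell N j) (hl : x ∈ cell N l) : j = l := by
  rw [mem_cell_iff_floor_eq] at hj hl
  exact Fin.ext (by exact_mod_cast hj.symm.trans hl)

theorem exists_mem_cell {x : ℝ} (hx : x ∈ Set.Ico (0 : ℝ) 1) : ∃ j, x ∈ cell N j := by
  have hN : (0 : ℝ) < N := by exact_mod_cast NeZero.pos N
  have hx' : 0 ≤ N * x := mul_nonneg hN.le hx.1
  refine ⟨⟨⌊N * x⌋₊, (Nat.floor_lt hx').2 (mul_lt_of_lt_one_right hN hx.2)⟩, ?_⟩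
  rw [mem_cell_iff_floor_eq, Int.natCast_floor_eq_floor hx']

theorem branch_shiftMap {x : ℝ} (hx : x ∈ cell N j) : branch N j (shiftMap N x) = x := by
  have hN : (N : ℝ) ≠ 0 := by exact_mod_cast NeZero.ne N
  have hfloor : ((⌊N * x⌋ : ℤ) : ℝ) = j := by exact_mod_cast mem_cell_iff_floor_eq.1 hx
  rw [branch, shiftMap, Int.fract, hfloor, sub_add_cancel, mul_div_cancel_left₀ _ hN]

theorem shiftMap_branch {x : ℝ} (hx : x ∈ Set.Ico (0 : ℝ) 1) : shiftMap N (branch N j x) = x := by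
  have hN : (N : ℝ) ≠ 0 := by exact_mod_cast NeZero.ne N
  rw [shiftMap, branch, mul_div_cancel₀ _ hN, Int.fract_add_natCast, Int.fract_eq_self.2 hx]

theorem branch_mem_cell_iff {x : ℝ} : branch N j x ∈ cell N j ↔ x ∈ Set.Ico (0 : ℝ) 1 := by
  have hN : (N : ℝ) ≠ 0 := by exact_mod_cast NeZero.ne N
  rw [mem_cell_iff_floor_eq, branch, mul_div_cancel₀ _ hN, Int.floor_add_natCast, add_eq_right,
    Int.floor_eq_zero_iff]

theorem cell_subset_Icc : cell N j ⊆ Set.Icc 0 1 := by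
  intro x hx
  have hN : (0 : ℝ) < N := by exact_mod_cast NeZero.pos N
  have hj : ((j : ℕ) : ℝ) + 1 ≤ N := by exact_mod_cast j.2
  exact ⟨(by positivity : (0 : ℝ) ≤ j / N).trans hx.1,
    hx.2.le.trans ((div_le_one hN).2 hj)⟩

theorem sum_indicator_cell {E : Type*} [AddCommMonoid E] (F : Fin N → ℝ → E) {x : ℝ}
    (hx : x ∈ cell N j) : ∑ l, (cell N l).indicator (F l) x = F j x := by
  rw [Finset.sum_eq_single j (fun l _ hl => ?_) (by simp), Set.indicator_of_mem hx]
  exact Set.indicator_of_notMem (fun hl' => hl (eq_of_mem_cell hl' hx)) _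

theorem stepFun_of_mem_cell {M : ℕ} (A : Matrix (Fin M) (Fin N) ℂ) (k : Fin M) {x : ℝ}
    (hx : x ∈ cell N j) : stepFun A k x = A k j :=
  sum_indicator_cell (fun l _ => A k l) hx

theorem μI_eq_restrict_Ico : μI = volume.restrict (Set.Ico (0 : ℝ) 1) :=
  restrict_Ico_eq_restrict_Icc.symm

theorem ae_mem_Ico : ∀ᵐ x ∂μI, x ∈ Set.Ico (0 : ℝ) 1 := by
  rw [μI_eq_restrict_Ico]
  exact ae_restrict_mem measurableSet_Ico

theorem measurableEmbedding_branch : MeasurableEmbedding (branch N j) := by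
  have hN : (N : ℝ) ≠ 0 := by exact_mod_cast NeZero.ne N
  exact (measurableEmbedding_mulRight₀ (inv_ne_zero hN)).comp (measurableEmbedding_addRight (j : ℝ))

theorem map_branch_volume : Measure.map (branch N j) volume = (N : ENNReal) • volume := by
  have hN : (N : ℝ) ≠ 0 := by exact_mod_cast NeZero.ne N
  have hcomp : branch N j = (fun x => x * (N : ℝ)⁻¹) ∘ fun x => x + (j : ℝ) := rfl
  rw [hcomp, ← Measure.map_map (measurable_mul_const _) (measurable_add_const _),
    map_add_right_eq_self, Real.map_volume_mul_right (inv_ne_zero hN), inv_inv, Nat.abs_cast,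
    ENNReal.ofReal_natCast]

theorem map_branch_μI :
    Measure.map (branch N j) μI = (N : ENNReal) • volume.restrict (cell N j) := by
  have hpre : branch N j ⁻¹' cell N j = Set.Ico 0 1 := Set.ext fun _ => branch_mem_cell_iff
  rw [μI_eq_restrict_Ico, ← hpre, ← Measure.restrict_map measurableEmbedding_branch.measurable
    measurableSet_cell, map_branch_volume, Measure.restrict_smul]

theorem map_branch_le : Measure.map (branch N j) μI ≤ (N : ENNReal) • μI := by
  rw [map_branch_μI]
  gcongr
  exact Measure.restrict_mono_set _ cell_subset_Icc

theorem quasiMeasurePreserving_branch : Measure.QuasiMeasurePreserving (branch N j) μI μI :=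
  ⟨measurableEmbedding_branch.measurable,
    (Measure.absolutelyContinuous_of_le map_branch_le).trans Measure.smul_absolutelyContinuous⟩

theorem integral_indicator_cell {E : Type*} [NormedAddCommGroup E] [NormedSpace ℝ E]
    (F : ℝ → E) : ∫ x, (cell N j).indicator F x ∂μI = (N : ℝ)⁻¹ • ∫ x, F (branch N j x) ∂μI := by
  have hN : (N : ℝ) ≠ 0 := by exact_mod_cast NeZero.ne N
  rw [← measurableEmbedding_branch.integral_map, map_branch_μI, integral_smul_measure,
    ENNReal.toReal_natCast, inv_smul_smul₀ hN, integral_indicator measurableSet_cell,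
    Measure.restrict_restrict measurableSet_cell, Set.inter_eq_left.2 cell_subset_Icc]

end Cells

section CuntzIsometries

variable {N : ℕ} [NeZero N]

/-- The Cuntz isometry `S_j f (x) = √N χ_[j/N, (j+1)/N)(x) f(N x mod 1)`. These are the operators
`V_j` attached to the matrix `√N I`. -/
noncomputable def cuntzIso (N : ℕ) [NeZero N] (j : Fin N) : L2I →L[ℂ] L2I :=
  walshOp (((√N : ℝ) : ℂ) • (1 : Matrix (Fin N) (Fin N) ℂ)) j

theorem cuntzIso_coeFn (j : Fin N) (f : L2I) :
    cuntzIso N j f =ᵐ[μI] (cell N j).indicator fun x => ((√N : ℝ) : ℂ) * f (shiftMap N x) := by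
  filter_upwards [walshOp_coeFn (((√N : ℝ) : ℂ) • (1 : Matrix (Fin N) (Fin N) ℂ)) j f, ae_mem_Ico]
    with x hS hx
  obtain ⟨l, hl⟩ := exists_mem_cell (N := N) hx
  rw [cuntzIso, hS, stepFun_of_mem_cell _ _ hl, Matrix.smul_apply, Matrix.one_apply]
  split_ifs with hjl
  · rw [hjl, Set.indicator_of_mem hl, smul_eq_mul, mul_one]
  · rw [Set.indicator_of_notMem fun hj => hjl (eq_of_mem_cell hj hl), smul_zero, zero_mul]

theorem ofReal_sqrt_ne_zero : ((√N : ℝ) : ℂ) ≠ 0 := by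
  exact_mod_cast (Real.sqrt_pos.2 (by exact_mod_cast NeZero.pos N)).ne'

theorem walshOp_eq_sum_cuntzIso {M : ℕ} (A : Matrix (Fin M) (Fin N) ℂ) (k : Fin M) :
    walshOp A k = ∑ j, (((√N : ℝ) : ℂ)⁻¹ • A) k j • cuntzIso N j := by
  have hN := ofReal_sqrt_ne_zero (N := N)
  ext1 f
  refine Lp.ext ?_
  rw [sum_apply]
  have hsmul : ∀ᵐ x ∂μI, ∀ j, ((((√N : ℝ) : ℂ)⁻¹ • A) k j • cuntzIso N j) f x =
      (cell N j).indicator (fun x => A k j * f (shiftMap N x)) x := by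
    refine ae_all_iff.2 fun j => ?_
    filter_upwards [Lp.coeFn_smul ((((√N : ℝ) : ℂ)⁻¹ • A) k j) (cuntzIso N j f),
      cuntzIso_coeFn j f] with x hx hS
    rw [smul_apply, hx, Pi.smul_apply, hS]
    by_cases hj : x ∈ cell N j
    · simp only [Set.indicator_of_mem hj, Matrix.smul_apply, smul_eq_mul]
      field_simp
    · simp only [Set.indicator_of_notMem hj, smul_zero]
  filter_upwards [walshOp_coeFn A k f, Lp.coeFn_fun_finsetSum Finset.univ
    fun j => ((((√N : ℝ) : ℂ)⁻¹ • A) k j • cuntzIso N j) f, hsmul, ae_mem_Ico]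
    with x hV hsum hS hx
  obtain ⟨l, hl⟩ := exists_mem_cell (N := N) hx
  rw [hV, hsum, stepFun_of_mem_cell _ _ hl]
  simp only [hS]
  rw [sum_indicator_cell _ hl]

theorem krausMap_walshOp_eq_krausMap_cuntzIso {M : ℕ} {A : Matrix (Fin M) (Fin N) ℂ}
    (hA : (1 / (N : ℂ)) • (Aᴴ * A) = 1) : krausMap (walshOp A) = krausMap (cuntzIso N) := by
  rw [funext (walshOp_eq_sum_cuntzIso A)]
  refine krausMap_sum_smul ?_ _
  have hsq : ((√N : ℝ) : ℂ)⁻¹ * ((√N : ℝ) : ℂ)⁻¹ = 1 / (N : ℂ) := by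
    rw [← mul_inv, ← Complex.ofReal_mul, Real.mul_self_sqrt N.cast_nonneg, one_div,
      Complex.ofReal_natCast]
  rw [Matrix.conjTranspose_smul, Matrix.smul_mul, Matrix.mul_smul, smul_smul, star_inv₀,
    Complex.star_def, Complex.conj_ofReal, hsq, hA]

theorem adjoint_cuntzIso_coeFn (j : Fin N) (f : L2I) :
    adjoint (cuntzIso N j) f =ᵐ[μI] ((√N : ℝ) : ℂ)⁻¹ • (f ∘ branch N j) := by
  have hmem : MemLp (f ∘ branch N j) 2 μI :=
    ((Lp.memLp f).of_measure_le_smul (ENNReal.natCast_ne_top N) map_branch_le).comp_of_map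
      measurableEmbedding_branch.measurable.aemeasurable
  suffices h : adjoint (cuntzIso N j) f = (hmem.const_smul ((√N : ℝ) : ℂ)⁻¹).toLp _ from
    h ▸ MemLp.coeFn_toLp _
  refine ext_inner_left ℂ fun g => ?_
  rw [adjoint_inner_right, L2.inner_def, L2.inner_def]
  calc ∫ x, inner ℂ (cuntzIso N j g x) (f x) ∂μI
      = ∫ x, (cell N j).indicator
          (fun x => inner ℂ (((√N : ℝ) : ℂ) * g (shiftMap N x)) (f x)) x ∂μI := by
        refine integral_congr_ae ?_
        filter_upwards [cuntzIso_coeFn j g] with x hS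
        rw [hS]
        by_cases hx : x ∈ cell N j
        · simp only [Set.indicator_of_mem hx]
        · simp only [Set.indicator_of_notMem hx, inner_zero_left]
    _ = (N : ℝ)⁻¹ • ∫ x, inner ℂ (((√N : ℝ) : ℂ) * g (shiftMap N (branch N j x)))
          (f (branch N j x)) ∂μI := integral_indicator_cell _
    _ = ∫ x, inner ℂ (g x) ((hmem.const_smul ((√N : ℝ) : ℂ)⁻¹).toLp _ x) ∂μI := by
        rw [← integral_smul]
        refine integral_congr_ae ?_
        filter_upwards [(hmem.const_smul ((√N : ℝ) : ℂ)⁻¹).coeFn_toLp, ae_mem_Ico] with x hT hx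
        have hsqrt : (N : ℝ)⁻¹ * √N = (√N)⁻¹ := by
          rw [← div_eq_inv_mul, Real.sqrt_div_self]
        rw [hT, shiftMap_branch hx, ← smul_eq_mul, inner_smul_left, Complex.conj_ofReal,
          Complex.real_smul, ← mul_assoc, ← Complex.ofReal_mul, hsqrt, Pi.smul_apply,
          inner_smul_right, Complex.ofReal_inv, Function.comp_apply]

theorem krausMap_cuntzIso_one : krausMap (cuntzIso N) 1 = 1 := by
  have hN := ofReal_sqrt_ne_zero (N := N)
  ext1 f
  refine Lp.ext ?_
  simp only [krausMap_apply, mul_one, star_eq_adjoint, sum_apply, mul_apply_eq_comp,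
    one_apply_eq_self]
  have hproj : ∀ᵐ x ∂μI, ∀ j, cuntzIso N j (adjoint (cuntzIso N j) f) x =
      (cell N j).indicator f x := by
    refine ae_all_iff.2 fun j => ?_
    filter_upwards [cuntzIso_coeFn j (adjoint (cuntzIso N j) f),
      (measurePreserving_shiftMap N).quasiMeasurePreserving.ae (adjoint_cuntzIso_coeFn j f)]
      with x hS hT
    rw [hS]
    by_cases hx : x ∈ cell N j
    · simp only [Set.indicator_of_mem hx, hT, Pi.smul_apply, Function.comp_apply,
        branch_shiftMap hx, smul_eq_mul, mul_inv_cancel_left₀ hN]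
    · simp only [Set.indicator_of_notMem hx]
  filter_upwards [Lp.coeFn_fun_finsetSum Finset.univ
    fun j => cuntzIso N j (adjoint (cuntzIso N j) f), hproj, ae_mem_Ico] with x hsum hS hx
  obtain ⟨l, hl⟩ := exists_mem_cell (N := N) hx
  rw [hsum]
  simp only [hS]
  exact sum_indicator_cell (fun _ => f) hl

end CuntzIsometries

section LipschitzDecay

open InnerProductSpace (rankOne)

variable {N : ℕ} [NeZero N]

theorem oneL2_coeFn : oneL2 =ᵐ[μI] fun _ => (1 : ℂ) := Lp.coeFn_const ..

theorem norm_oneL2 : ‖oneL2‖ = 1 :=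
  (Lp.norm_const' (μ := μI) (p := 2) (c := (1 : ℂ)) (by simp) (by simp)).trans (by simp)

theorem walshOp_oneL2 {M : ℕ} {A : Matrix (Fin M) (Fin N) ℂ} {k : Fin M}
    (hrow : ∀ j, A k j = 1) : walshOp A k oneL2 = oneL2 := by
  refine Lp.ext ?_
  filter_upwards [walshOp_coeFn A k oneL2, oneL2_coeFn,
    (measurePreserving_shiftMap N).quasiMeasurePreserving.ae oneL2_coeFn, ae_mem_Ico]
    with x hV hone hshift hx
  obtain ⟨j, hj⟩ := exists_mem_cell (N := N) hx
  rw [hV, stepFun_of_mem_cell A k hj, hrow, hshift, hone, mul_one]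

theorem norm_sub_smul_oneL2_le_of_lipschitzWith {K : NNReal} {g : ℝ → ℂ}
    (hg : LipschitzWith K g) {f : L2I} (hfg : f =ᵐ[μI] g) : ‖f - g 0 • oneL2‖ ≤ K := by
  refine (Lp.norm_le_of_ae_bound K.2 ?_).trans_eq (by simp [measureUnivNNReal])
  filter_upwards [Lp.coeFn_sub f (g 0 • oneL2), Lp.coeFn_smul (g 0) oneL2, oneL2_coeFn, hfg,
    ae_mem_Ico] with x hsub hsmul hone hx hx01
  rw [hsub, Pi.sub_apply, hsmul, Pi.smul_apply, hone, hx, smul_eq_mul, mul_one, ← dist_eq_norm]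
  refine (hg.dist_le_mul x 0).trans (mul_le_of_le_one_right K.2 ?_)
  rw [dist_zero_right, Real.norm_of_nonneg hx01.1]
  exact hx01.2.le

/-- Each application of `S_j⋆` divides the Lipschitz constant by `N √N`. -/
theorem reApplyInnerSelf_iterate_krausMap_cuntzIso_le {K : NNReal} {g : ℝ → ℂ}
    (hg : LipschitzWith K g) {f : L2I} (hfg : f =ᵐ[μI] g) (n : ℕ) :
    ((krausMap (cuntzIso N))^[n] (1 - rankOne ℂ oneL2 oneL2)).reApplyInnerSelf f ≤
      (K / N ^ n) ^ 2 := by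
  induction n generalizing f g K with
  | zero =>
    refine (reApplyInnerSelf_one_sub_rankOne_le norm_oneL2 (g 0) f).trans ?_
    rw [pow_zero, div_one]
    gcongr
    exact norm_sub_smul_oneL2_le_of_lipschitzWith hg hfg
  | succ n ih =>
    have hN : (0 : ℝ) < N := by exact_mod_cast NeZero.pos N
    rw [Function.iterate_succ_apply', reApplyInnerSelf_krausMap]
    refine (Finset.sum_le_card_nsmul _ _ _ fun j _ =>
      ih ((lipschitzWith_smul ((√N : ℝ) : ℂ)⁻¹).comp (hg.comp (lipschitzWith_branch (j := j))))
        ?_).trans_eq ?_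
    · filter_upwards [adjoint_cuntzIso_coeFn j f, (quasiMeasurePreserving_branch (j := j)).ae hfg]
        with x hT hx
      rw [hT, Pi.smul_apply, Function.comp_apply, hx, Function.comp_apply, Function.comp_apply]
    · rw [Finset.card_univ, Fintype.card_fin, nsmul_eq_mul]
      push_cast
      rw [norm_inv, Complex.norm_real, Real.norm_of_nonneg (Real.sqrt_nonneg _)]
      field_simp
      rw [Real.sq_sqrt hN.le]
      ring

theorem dense_setOf_ae_eq_lipschitzWith :
    Dense {f : L2I | ∃ (K : NNReal) (g : ℝ → ℂ), LipschitzWith K g ∧ f =ᵐ[μI] g} := by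
  refine (Lp.dense_hasCompactSupport_contDiff (by simp)).mono ?_
  rintro f ⟨g, hfg, hsupp, hdiff⟩
  obtain ⟨K, hK⟩ := ContDiff.lipschitzWith_of_hasCompactSupport hsupp hdiff (by simp)
  exact ⟨K, g, hK, hfg⟩

theorem tendsto_reApplyInnerSelf_iterate_krausMap_cuntzIso (hN : 2 ≤ N) {K : NNReal} {g : ℝ → ℂ}
    (hg : LipschitzWith K g) {f : L2I} (hfg : f =ᵐ[μI] g) :
    Tendsto (fun n => ((krausMap (cuntzIso N))^[n]
      (1 - rankOne ℂ oneL2 oneL2)).reApplyInnerSelf f) atTop (𝓝 0) := by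
  have hpow : Tendsto (fun n => (N : ℝ) ^ n) atTop atTop :=
    tendsto_pow_atTop_atTop_of_one_lt (by exact_mod_cast hN)
  have hbound : Tendsto (fun n => ((K : ℝ) / N ^ n) ^ 2) atTop (𝓝 0) := by
    simpa using (hpow.const_div_atTop (K : ℝ)).pow 2
  refine squeeze_zero (fun n => reApplyInnerSelf_nonneg ?_ f)
    (reApplyInnerSelf_iterate_krausMap_cuntzIso_le hg hfg) hbound
  exact iterate_krausMap_nonneg _ (sub_nonneg.2 (rankOne_self_le_one norm_oneL2)) n

end LipschitzDecay

end WalshFrame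

theorem mainTheorem12 (M N : ℕ) [NeZero M] [NeZero N] (hN : 2 ≤ N)
    (A : Matrix (Fin M) (Fin N) ℂ)
    (hA : (1 / (N : ℂ)) • (A.conjTranspose * A) = 1)
    (hrow : ∀ j : Fin N, A 0 j = 1) :
    WalshFrame.IsParsevalFrame
      (fun ω : WalshFrame.WordsNotEndingInZero M =>
        WalshFrame.wordOp A ω.1 WalshFrame.oneL2) := by
  have hkraus := WalshFrame.krausMap_walshOp_eq_krausMap_cuntzIso hA
  refine WalshFrame.isParsevalFrame_of_tendsto_iterate_krausMap
    (hkraus ▸ WalshFrame.krausMap_cuntzIso_one) (WalshFrame.walshOp_oneL2 hrow)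
    WalshFrame.norm_oneL2 WalshFrame.dense_setOf_ae_eq_lipschitzWith ?_
  rintro f ⟨K, g, hg, hfg⟩
  rw [hkraus]
  exact WalshFrame.tendsto_reApplyInnerSelf_iterate_krausMap_cuntzIso hN hg hfg
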